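/- Let $\mathcal S,\mathcal X,\mathcal Y,\mathcal Z$ be finite alphabets, let $p(s)$ be a probability mass function on $\mathcal S$ and let $p(y,z|x,s)$ be a channel from $\mathcal X\times\mathcal S$ to $\mathcal Y\times\mathcal Z$. All information quantities are in bits. For block length $n$, the state sequence $S^n$ is i.i.d. with law $p(s)$; an encoder is a conditional law $p(x^n|s^n)$, by which the input $X^n$ is drawn given the entire state sequence $S^n$; and the outputs are drawn with conditional law $\prod_{i=1}^n p(y_i,z_i|x_i,s_i)$. A pair $(R_a,R_l)\in\mathbb R^2$ is called achievable if for every $\epsilon>0$ and all sufficiently large $n$ there is an encoder of block length $n$ with $$\frac1n I(S^n;Y^n)\ge R_a-\epsilon\qquad\text{and}\qquad \frac1n I(S^n;Z^n)\le R_l+\epsilon .$$ Let $\mathcal C$ be the set of achievable pairs. **Proposition.** Let $\mathcal R^2$ be the closure in $\mathbb R^2$ of the union, over all finite alphabets $\mathcal U$ and all conditional laws $p(u,x|s)$ from $\mathcal S$ to $\mathcal U\times\mathcal X$, of the sets of pairs $(R_a,R_l)$ satisfying $$R_a\le\min\{H(S),I(U,S;Y)\},\qquad R_l\ge I(U,S;Z),\qquad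 0\le I(U;Y)-I(U;S),$$ where $(S,U,X,Y,Z)$ has the joint law $p(s)\,p(u,x|s)\,p(y,z|x,s)$. Then $\mathcal R^2\subseteq\mathcal C$. -/

import Mathlib

namespace StateAmplification

open Filter

noncomputable section

/-- Shannon entropy, in bits, of a probability mass function on a finite alphabet. -/
def entropy {α : Type*} [Fintype α] (p : PMF α) : ℝ :=
  (∑ a, Real.negMulLog (p a).toReal) / Real.log 2

/-- `H(A)` for a random variable `A` on a space with law `P`. -/
def rvEntropy {Ω α : Type*} [Fintype α] (P : PMF Ω) (A : Ω → α) : ℝ :=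
  entropy (P.map A)

/-- `I(A;B) = H(A) + H(B) - H(A,B)` for random variables `A`, `B` on a space with law `P`. -/
def mutualInfo {Ω α β : Type*} [Fintype α] [Fintype β] (P : PMF Ω) (A : Ω → α) (B : Ω → β) : ℝ :=
  rvEntropy P A + rvEntropy P B - rvEntropy P (fun ω => (A ω, B ω))

/-- The law of independent coordinates `A_1, …, A_n`, where `A_i` has law `p i`. -/
def productPMF {n : ℕ} {α : Type*} [Fintype α] (p : Fin n → PMF α) : PMF (Fin n → α) :=
  PMF.ofFintype (fun a => ∏ i, p i (a i)) (by
    classical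
    rw [← Fintype.piFinset_univ, ← Finset.prod_univ_sum]
    refine Finset.prod_eq_one fun i _ => ?_
    rw [← tsum_fintype (L := .unconditional _)]
    exact (p i).tsum_coe)

/-- A (stochastic) encoder of block length `n` that knows the state sequence non-causally:
a conditional law `p(x^n | s^n)`. -/
abbrev Encoder (S X : Type*) (n : ℕ) : Type _ := (Fin n → S) → PMF (Fin n → X)

/-- The joint law of `(S^n, Y^n, Z^n)`: the state is i.i.d. with law `p`, the input `X^n` is drawn
by the encoder from `S^n`, and the outputs come from the memoryless channel `W = p(y,z|x,s)`. -/
def blockLaw {S X Y Z : Type*} [Fintype S] [Fintype Y] [Fintype Z]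
    (p : PMF S) (W : X → S → PMF (Y × Z)) {n : ℕ} (f : Encoder S X n) :
    PMF ((Fin n → S) × (Fin n → Y) × (Fin n → Z)) :=
  (productPMF fun _ => p).bind fun s =>
    (f s).bind fun x =>
      (productPMF fun i => W (x i) (s i)).map fun yz =>
        (s, (fun i => (yz i).1), (fun i => (yz i).2))

/-- The pair `r = (R_a, R_l)` is achievable: for every `ε > 0` and all sufficiently large `n` some
encoder has `I(S^n;Y^n)/n ≥ R_a - ε` and `I(S^n;Z^n)/n ≤ R_l + ε`. -/
def Achievable {S X Y Z : Type*} [Fintype S] [Fintype Y] [Fintype Z]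
    (p : PMF S) (W : X → S → PMF (Y × Z)) (r : ℝ × ℝ) : Prop :=
  ∀ ε : ℝ, 0 < ε → ∀ᶠ n : ℕ in atTop, ∃ f : Encoder S X n,
    r.1 - ε ≤ (1 / (n : ℝ)) * mutualInfo (blockLaw p W f) (fun ω => ω.1) (fun ω => ω.2.1) ∧
    (1 / (n : ℝ)) * mutualInfo (blockLaw p W f) (fun ω => ω.1) (fun ω => ω.2.2) ≤ r.2 + ε

/-- The trade-off region `𝒞`. -/
def tradeoffRegion {S X Y Z : Type*} [Fintype S] [Fintype Y] [Fintype Z]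
    (p : PMF S) (W : X → S → PMF (Y × Z)) : Set (ℝ × ℝ) :=
  {r | Achievable p W r}

/-- The joint law `p(s) p(u,x|s) p(y,z|x,s)` of `(S, U, X, Y, Z)`. -/
def letterLaw {S U X Y Z : Type*} (p : PMF S) (W : X → S → PMF (Y × Z)) (q : S → PMF (U × X)) :
    PMF (S × U × X × Y × Z) :=
  p.bind fun s => (q s).bind fun ux => (W ux.2 s).map fun yz => (s, ux.1, ux.2, yz.1, yz.2)

/-- The pairs `(R_a, R_l)` that satisfy, for the given `q = p(u,x|s)`,
`R_a ≤ min {H(S), I(U,S;Y)}`, `R_l ≥ I(U,S;Z)` and `0 ≤ I(U;Y) - I(U;S)`. -/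
def messagingPairs {S U X Y Z : Type*} [Fintype S] [Fintype U] [Fintype Y] [Fintype Z]
    (p : PMF S) (W : X → S → PMF (Y × Z)) (q : S → PMF (U × X)) : Set (ℝ × ℝ) :=
  let P := letterLaw p W q
  let rvS : S × U × X × Y × Z → S := fun ω => ω.1
  let rvU : S × U × X × Y × Z → U := fun ω => ω.2.1
  let rvY : S × U × X × Y × Z → Y := fun ω => ω.2.2.2.1
  let rvZ : S × U × X × Y × Z → Z := fun ω => ω.2.2.2.2
  {r | r.1 ≤ min (rvEntropy P rvS) (mutualInfo P (fun ω => (rvU ω, rvS ω)) rvY) ∧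
       mutualInfo P (fun ω => (rvU ω, rvS ω)) rvZ ≤ r.2 ∧
       0 ≤ mutualInfo P rvU rvY - mutualInfo P rvU rvS}

/-- The region `ℛ²`: the closure of the union of the above pairs over all finite alphabets of the
auxiliary variable `U` and all `p(u,x|s)`. -/
def messagingRegion {S X Y Z : Type*} [Fintype S] [Fintype Y] [Fintype Z]
    (p : PMF S) (W : X → S → PMF (Y × Z)) : Set (ℝ × ℝ) :=
  closure {r | ∃ (U : Type) (_ : Fintype U) (q : S → PMF (U × X)), r ∈ messagingPairs p W q}

end

end StateAmplification

set_option linter.unusedSectionVars false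

namespace StateAmplification

open Filter

/-! ### Moments of functions of independent coordinates. -/

section ProductSums

variable {ι α : Type*} [Fintype ι] [DecidableEq ι] [Fintype α]

/-! Random coding: each state sequence `s` gets its own codeword `f s`, drawn independently from
`Q(·|s)`, and `x_i` is drawn from `κ(·|s_i,u_i)`. For a fixed `f` the codeword is a function of the
state, so the state carries all the information that the pair (state, codeword) has about an output.

Upper bounds hold codebook by codebook. Replacing the output law of the code by the averaged law
`outLaw` only adds a relative entropy (`codeInfo_le_add_codeDev`), which bounds the leakage by
`I(U,S;Z)` up to a deviation; trivially the information is also at most the self-information. The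
lower bound holds on average. By the tangent line of the logarithm, the random output law may be
replaced by `p(s)V(y|s,u) + outLaw(y)`, which is at most twice its larger term, giving `min(H(S),
I(U,S;Y))` up to `log 2` and deviations (`sub_le_sum_codebook_mul_codeInfo`). A first-moment
argument then finds one codebook good for both receivers (`exists_codebook`).

For blocks of length `n` the deviations are those of i.i.d. sums, hence `O(√n)`, and vanish after
division by `n`. The region is closed, so the closure comes for free. -/

lemma sum_prod_mul_apply {r : ι → α → ℝ} (hr : ∀ k, ∑ x, r k x = 1) (i : ι) (a : α → ℝ) :
    ∑ t : ι → α, (∏ k, r k (t k)) * a (t i) = ∑ x, r i x * a x := by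
  -- The test function is absorbed into the `i`-th factor, so that the sum over tuples factorises.
  have h := Finset.prod_univ_sum (fun _ : ι => (Finset.univ : Finset α))
    (fun k x => r k x * if k = i then a x else 1)
  rw [Fintype.piFinset_univ] at h
  have h1 : ∀ t : ι → α, (∏ k, r k (t k)) * a (t i) =
      ∏ k, (r k (t k) * if k = i then a (t k) else 1) := fun t => by
    rw [Finset.prod_mul_distrib]; simp
  simp_rw [h1]
  rw [← h, Finset.prod_eq_single i]
  · simp
  · intro k _ hk; simp [hk, hr]
  · simp

lemma sum_prod_mul_apply_mul_apply {r : ι → α → ℝ} (hr : ∀ k, ∑ x, r k x = 1) {i j : ι}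
    (hij : i ≠ j) (a b : α → ℝ) :
    ∑ t : ι → α, (∏ k, r k (t k)) * (a (t i) * b (t j)) =
      (∑ x, r i x * a x) * ∑ x, r j x * b x := by
  have h := Finset.prod_univ_sum (fun _ : ι => (Finset.univ : Finset α))
    (fun k x => r k x * ((if k = i then a x else 1) * if k = j then b x else 1))
  rw [Fintype.piFinset_univ] at h
  have h1 : ∀ t : ι → α, (∏ k, r k (t k)) * (a (t i) * b (t j)) =
      ∏ k, (r k (t k) * ((if k = i then a (t k) else 1) * if k = j then b (t k) else 1)) :=
    fun t => by
      rw [Finset.prod_mul_distrib, Finset.prod_mul_distrib]; simp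
  simp_rw [h1]
  rw [← h, Finset.prod_eq_mul i j hij]
  · simp [hij, hij.symm]
  · intro k _ hk; simp [hk.1, hk.2, hr]
  · simp
  · simp

lemma sum_prod_eq_one {r : ι → α → ℝ} (hr : ∀ k, ∑ x, r k x = 1) :
    ∑ t : ι → α, ∏ k, r k (t k) = 1 := by
  rw [← Fintype.piFinset_univ, ← Finset.prod_univ_sum]
  exact Finset.prod_eq_one fun i _ => hr i

/-- The second moment of a sum of centred i.i.d. variables. -/
lemma sum_prod_mul_sq_sum {r : α → ℝ} (hr : ∑ x, r x = 1) {h : α → ℝ}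
    (hh : ∑ x, r x * h x = 0) :
    ∑ t : ι → α, (∏ k, r (t k)) * (∑ i, h (t i)) ^ 2 =
      Fintype.card ι * ∑ x, r x * h x ^ 2 := by
  have e : ∀ t : ι → α, (∏ k, r (t k)) * (∑ i, h (t i)) ^ 2 =
      ∑ i, ∑ j, (∏ k, r (t k)) * (h (t i) * h (t j)) := fun t => by
    rw [sq, Finset.sum_mul_sum, Finset.mul_sum]
    simp_rw [Finset.mul_sum]
  simp_rw [e]
  rw [Finset.sum_comm]
  have : ∀ i : ι, ∑ t : ι → α, ∑ j, (∏ k, r (t k)) * (h (t i) * h (t j)) =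
      ∑ x, r x * h x ^ 2 := fun i => by
    rw [Finset.sum_comm, Finset.sum_eq_single i]
    · rw [sum_prod_mul_apply (r := fun _ => r) (fun _ => hr) i (fun x => h x * h x)]
      simp_rw [sq]
    · intro j _ hj
      rw [sum_prod_mul_apply_mul_apply (r := fun _ => r) (fun _ => hr) hj.symm, hh, zero_mul]
    · simp
  simp [this]

/-- The mean absolute deviation of a sum of `n` i.i.d. variables is of order at most `√n`. -/
lemma exists_sum_prod_mul_abs_le {r : α → ℝ} (hr0 : ∀ x, 0 ≤ r x) (hr : ∑ x, r x = 1)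
    (g : α → ℝ) : ∃ K : ℝ, ∀ n : ℕ,
      ∑ t : Fin n → α, (∏ k, r (t k)) * |∑ i, g (t i) - n * ∑ x, r x * g x| ≤ K * √n := by
  set m := ∑ x, r x * g x with hm
  have hh : ∑ x, r x * (g x - m) = 0 := by
    simp_rw [mul_sub]; rw [Finset.sum_sub_distrib, ← Finset.sum_mul, hr, ← hm]; ring
  -- From `|x| ≤ x²/(2√n) + √n/2`, where the second moment of the centred sum is `n` times the
  -- variance.
  refine ⟨(∑ x, r x * (g x - m) ^ 2 + 1) / 2, fun n => ?_⟩
  rcases Nat.eq_zero_or_pos n with rfl | hn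
  · simp
  have hs : 0 < √(n : ℝ) := Real.sqrt_pos.2 (by exact_mod_cast hn)
  have hss : √(n : ℝ) * √n = n := Real.mul_self_sqrt (by positivity)
  have key := sum_prod_mul_sq_sum (ι := Fin n) hr hh
  have hP := sum_prod_eq_one (ι := Fin n) (r := fun _ => r) (fun _ => hr)
  calc ∑ t : Fin n → α, (∏ k, r (t k)) * |∑ i, g (t i) - n * m|
      ≤ ∑ t : Fin n → α, ((1 / (2 * √n)) * ((∏ k, r (t k)) * (∑ i, (g (t i) - m)) ^ 2) +
          √n / 2 * ∏ k, r (t k)) := by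
        refine Finset.sum_le_sum fun t _ => ?_
        have e : ∑ i, (g (t i) - m) = ∑ i, g (t i) - n * m := by simp
        rw [e]
        set x := ∑ i, g (t i) - n * m
        have : |x| ≤ 1 / (2 * √n) * x ^ 2 + √n / 2 := by
          rw [← sq_abs]
          have h2 : 1 / (2 * √n) * |x| ^ 2 + √n / 2 - |x| = (|x| - √n) ^ 2 / (2 * √n) := by
            field_simp; ring
          have : 0 ≤ (|x| - √n) ^ 2 / (2 * √n) := by positivity
          linarith
        have hp : 0 ≤ ∏ k, r (t k) := Finset.prod_nonneg fun _ _ => hr0 _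
        calc _ ≤ _ := mul_le_mul_of_nonneg_left this hp
          _ = _ := by ring
    _ = (∑ x, r x * (g x - m) ^ 2 + 1) / 2 * √n := by
        rw [Finset.sum_add_distrib, ← Finset.mul_sum, ← Finset.mul_sum, hP, key, Fintype.card_fin]
        generalize √(n : ℝ) = q at *
        rw [← hss]; field_simp

end ProductSums

/-! ### One-shot random coding bounds. -/

noncomputable section RandomCoding

variable {S U Y Z : Type*} [Fintype S] [Fintype U] [Fintype Y] [Fintype Z]

/-- Output law of the channel `V` when `s` has law `p` and `u = f s`. -/
def codeOut (p : S → ℝ) (V : S → U → Y → ℝ) (f : S → U) (y : Y) : ℝ :=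
  ∑ s, p s * V s (f s) y

/-- Mutual information, in nats, of the state and the output of `V` when `u = f s`. -/
def codeInfo (p : S → ℝ) (V : S → U → Y → ℝ) (f : S → U) : ℝ :=
  ∑ s, ∑ y, p s * V s (f s) y * (Real.log (V s (f s) y) - Real.log (codeOut p V f y))

/-- Output law of the channel `V` under the joint law `p(s) Q(u|s)`. -/
def outLaw (p : S → ℝ) (Q : S → U → ℝ) (V : S → U → Y → ℝ) (y : Y) : ℝ :=
  ∑ s, ∑ u, p s * Q s u * V s u y

/-- Information density of `(s, u)` and `y`, in nats. -/
def infoDensity (p : S → ℝ) (Q : S → U → ℝ) (V : S → U → Y → ℝ) (s : S) (u : U) (y : Y) : ℝ :=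
  Real.log (V s u y) - Real.log (outLaw p Q V y)

/-- Mean absolute deviation of the information density from `i`, given the codebook `f`. -/
def codeDev (p : S → ℝ) (Q : S → U → ℝ) (V : S → U → Y → ℝ) (i : ℝ) (f : S → U) : ℝ :=
  ∑ s, ∑ y, p s * V s (f s) y * |infoDensity p Q V s (f s) y - i|

/-- Mean absolute deviation of the information density from `i`. -/
def densityDev (p : S → ℝ) (Q : S → U → ℝ) (V : S → U → Y → ℝ) (i : ℝ) : ℝ :=
  ∑ s, ∑ u, ∑ y, p s * Q s u * V s u y * |infoDensity p Q V s u y - i|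

/-- Mean absolute deviation of the self-information from `h`. -/
def selfDev (p : S → ℝ) (h : ℝ) : ℝ := ∑ s, p s * |-Real.log (p s) - h|

variable {p : S → ℝ} {Q : S → U → ℝ} {V : S → U → Y → ℝ}

/-- The summand at `s` involves the codebook only through `f s`, which has law `Q s`. -/
lemma sum_codebook_mul_codeDev [DecidableEq S] (hQ : ∀ s, ∑ u, Q s u = 1) (i : ℝ) :
    ∑ f : S → U, (∏ s, Q s (f s)) * codeDev p Q V i f = densityDev p Q V i := by
  unfold codeDev densityDev
  simp_rw [Finset.mul_sum]
  rw [Finset.sum_comm]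
  refine Finset.sum_congr rfl fun s _ => ?_
  rw [Finset.sum_comm]
  conv_rhs => rw [Finset.sum_comm]
  refine Finset.sum_congr rfl fun y _ => ?_
  rw [sum_prod_mul_apply hQ s (fun u => p s * V s u y * |infoDensity p Q V s u y - i|)]
  exact Finset.sum_congr rfl fun u _ => by ring

lemma codeOut_nonneg (hp : ∀ s, 0 ≤ p s) (hV : ∀ s u y, 0 ≤ V s u y) (f : S → U) (y : Y) :
    0 ≤ codeOut p V f y :=
  Finset.sum_nonneg fun s _ => mul_nonneg (hp s) (hV _ _ _)

lemma outLaw_nonneg (hp : ∀ s, 0 ≤ p s) (hQ : ∀ s u, 0 ≤ Q s u) (hV : ∀ s u y, 0 ≤ V s u y)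
    (y : Y) : 0 ≤ outLaw p Q V y :=
  Finset.sum_nonneg fun s _ => Finset.sum_nonneg fun u _ =>
    mul_nonneg (mul_nonneg (hp s) (hQ s u)) (hV _ _ _)

lemma le_codeOut (hp : ∀ s, 0 ≤ p s) (hV : ∀ s u y, 0 ≤ V s u y) (f : S → U) (s : S) (y : Y) :
    p s * V s (f s) y ≤ codeOut p V f y :=
  Finset.single_le_sum (f := fun s => p s * V s (f s) y)
    (fun s _ => mul_nonneg (hp s) (hV _ _ _)) (Finset.mem_univ s)

lemma le_outLaw (hp : ∀ s, 0 ≤ p s) (hQ : ∀ s u, 0 ≤ Q s u) (hV : ∀ s u y, 0 ≤ V s u y)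
    (s : S) (u : U) (y : Y) : p s * Q s u * V s u y ≤ outLaw p Q V y :=
  (Finset.single_le_sum (f := fun u => p s * Q s u * V s u y)
    (fun u _ => mul_nonneg (mul_nonneg (hp s) (hQ s u)) (hV _ _ _)) (Finset.mem_univ u)).trans
  (Finset.single_le_sum (f := fun s => ∑ u, p s * Q s u * V s u y)
    (fun s _ => Finset.sum_nonneg fun u _ => mul_nonneg (mul_nonneg (hp s) (hQ s u)) (hV _ _ _))
    (Finset.mem_univ s))

lemma sum_outLaw (hps : ∑ s, p s = 1) (hQs : ∀ s, ∑ u, Q s u = 1)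
    (hVs : ∀ s u, ∑ y, V s u y = 1) : ∑ y, outLaw p Q V y = 1 := by
  unfold outLaw
  rw [Finset.sum_comm, ← hps]
  refine Finset.sum_congr rfl fun s _ => ?_
  rw [Finset.sum_comm]
  simp_rw [← Finset.mul_sum, hVs, mul_one, ← Finset.mul_sum, hQs, mul_one]

lemma sum_codeOut (hps : ∑ s, p s = 1) (hVs : ∀ s u, ∑ y, V s u y = 1) (f : S → U) :
    ∑ y, codeOut p V f y = 1 := by
  unfold codeOut
  rw [Finset.sum_comm, ← hps]
  simp_rw [← Finset.mul_sum, hVs, mul_one]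

lemma sum_mul_const_add (hps : ∑ s, p s = 1) (hVs : ∀ s u, ∑ y, V s u y = 1) (f : S → U)
    (c : ℝ) (g : S → Y → ℝ) :
    ∑ s, ∑ y, p s * V s (f s) y * (c + g s y) = c + ∑ s, ∑ y, p s * V s (f s) y * g s y := by
  simp_rw [mul_add, Finset.sum_add_distrib]
  congr 1
  simp_rw [← Finset.sum_mul, ← Finset.mul_sum, hVs, mul_one]
  rw [hps, one_mul]

/-- The information of a codebook exceeds the self-information by at most its deviation. -/
lemma codeInfo_le_add_selfDev (hp : ∀ s, 0 ≤ p s) (hps : ∑ s, p s = 1)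
    (hV : ∀ s u y, 0 ≤ V s u y) (hVs : ∀ s u, ∑ y, V s u y = 1) (h : ℝ) (f : S → U) :
    codeInfo p V f ≤ h + selfDev p h := by
  have e : selfDev p h = ∑ s, ∑ y, p s * V s (f s) y * |-Real.log (p s) - h| := by
    simp_rw [selfDev, ← Finset.sum_mul, ← Finset.mul_sum, hVs, mul_one]
  rw [e, ← sum_mul_const_add hps hVs]
  refine Finset.sum_le_sum fun s _ => Finset.sum_le_sum fun y _ => ?_
  rcases (mul_nonneg (hp s) (hV s (f s) y)).eq_or_lt with h0 | h0
  · rw [← h0]; simp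
  refine mul_le_mul_of_nonneg_left ?_ h0.le
  have hp0 : p s ≠ 0 := fun h => by simp [h] at h0
  have hv0 : V s (f s) y ≠ 0 := fun h => by simp [h] at h0
  have := Real.log_le_log h0 (le_codeOut hp hV f s y)
  rw [Real.log_mul hp0 hv0] at this
  linarith [le_abs_self (-Real.log (p s) - h)]

/-- Replacing the output law of the codebook by the averaged one increases the information, the
difference being a relative entropy. -/
lemma codeInfo_le_add_codeDev (hp : ∀ s, 0 ≤ p s) (hps : ∑ s, p s = 1)
    (hQ : ∀ s u, 0 ≤ Q s u) (hQs : ∀ s, ∑ u, Q s u = 1)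
    (hV : ∀ s u y, 0 ≤ V s u y) (hVs : ∀ s u, ∑ y, V s u y = 1) (i : ℝ) {f : S → U}
    (hf : ∀ s, 0 < Q s (f s)) :
    codeInfo p V f ≤ i + codeDev p Q V i f := by
  have h1 : codeInfo p V f ≤ ∑ s, ∑ y, p s * V s (f s) y * infoDensity p Q V s (f s) y := by
    have e : ∑ s, ∑ y, p s * V s (f s) y * infoDensity p Q V s (f s) y - codeInfo p V f =
        ∑ y, codeOut p V f y * (Real.log (codeOut p V f y) - Real.log (outLaw p Q V y)) := by
      simp_rw [codeInfo, infoDensity, ← Finset.sum_sub_distrib]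
      rw [Finset.sum_comm]
      refine Finset.sum_congr rfl fun y _ => ?_
      conv_rhs => rw [codeOut, Finset.sum_mul]
      exact Finset.sum_congr rfl fun s _ => by rw [codeOut]; ring
    -- Termwise form of the nonnegativity of relative entropy; the left sides sum to `1 - 1 = 0`.
    have h2 : ∀ y, codeOut p V f y - outLaw p Q V y ≤
        codeOut p V f y * (Real.log (codeOut p V f y) - Real.log (outLaw p Q V y)) := by
      intro y
      rcases (codeOut_nonneg hp hV f y).eq_or_lt with h0 | h0
      · rw [← h0]; simpa using outLaw_nonneg hp hQ hV y
      -- Absolute continuity: codewords of positive probability are needed here, since `Real.log 0 =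
      -- 0`.
      have hpos : 0 < outLaw p Q V y := by
        obtain ⟨s, -, hs⟩ := Finset.exists_ne_zero_of_sum_ne_zero h0.ne'
        have hs' : 0 < p s * V s (f s) y :=
          lt_of_le_of_ne (mul_nonneg (hp s) (hV _ _ _)) hs.symm
        have := mul_pos hs' (hf s)
        have h3 := le_outLaw hp hQ hV s (f s) y
        nlinarith
      rw [← Real.log_div h0.ne' hpos.ne']
      have := Real.one_sub_inv_le_log_of_pos (div_pos h0 hpos)
      calc codeOut p V f y - outLaw p Q V y
          = codeOut p V f y * (1 - (codeOut p V f y / outLaw p Q V y)⁻¹) := by field_simp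
        _ ≤ _ := mul_le_mul_of_nonneg_left this h0.le
    have h3 := Finset.sum_le_sum fun y (_ : y ∈ Finset.univ) => h2 y
    rw [Finset.sum_sub_distrib, sum_codeOut hps hVs, sum_outLaw hps hQs hVs, ← e] at h3
    linarith
  refine h1.trans ?_
  rw [codeDev, ← sum_mul_const_add hps hVs]
  refine Finset.sum_le_sum fun s _ => Finset.sum_le_sum fun y _ =>
    mul_le_mul_of_nonneg_left ?_ (mul_nonneg (hp s) (hV _ _ _))
  linarith [le_abs_self (infoDensity p Q V s (f s) y - i)]

/-- Average of the output probability of `y`, weighted by a function of the codeword of `s`. -/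
lemma sum_codebook_mul_codeOut_le [DecidableEq S] (hp : ∀ s, 0 ≤ p s)
    (hQ : ∀ s u, 0 ≤ Q s u) (hQs : ∀ s, ∑ u, Q s u = 1) (hV : ∀ s u y, 0 ≤ V s u y)
    (s : S) (y : Y) {a : U → ℝ} (ha : ∀ u, 0 ≤ a u) :
    ∑ f : S → U, (∏ t, Q t (f t)) * (a (f s) * codeOut p V f y) ≤
      ∑ u, Q s u * (a u * (p s * V s u y + outLaw p Q V y)) := by
  have e : ∑ f : S → U, (∏ t, Q t (f t)) * (a (f s) * codeOut p V f y) =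
      ∑ t, p t * ∑ f : S → U, (∏ t, Q t (f t)) * (a (f s) * V t (f t) y) := by
    simp_rw [codeOut, Finset.mul_sum]
    rw [Finset.sum_comm]
    exact Finset.sum_congr rfl fun t _ => Finset.sum_congr rfl fun f _ => by ring
  have e2 : ∑ u, Q s u * (a u * (p s * V s u y + outLaw p Q V y)) =
      p s * ∑ u, Q s u * (a u * V s u y) +
        ∑ t, p t * ((∑ u, Q s u * a u) * ∑ u, Q t u * V t u y) := by
    have : outLaw p Q V y = ∑ t, p t * ∑ u, Q t u * V t u y := by
      simp_rw [outLaw, Finset.mul_sum]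
      exact Finset.sum_congr rfl fun t _ => Finset.sum_congr rfl fun u _ => by ring
    have e3 : ∑ t, p t * ((∑ u, Q s u * a u) * ∑ u, Q t u * V t u y) =
        (∑ u, Q s u * a u) * outLaw p Q V y := by
      rw [this, Finset.mul_sum]
      exact Finset.sum_congr rfl fun t _ => by ring
    rw [e3, Finset.mul_sum, Finset.sum_mul, ← Finset.sum_add_distrib]
    exact Finset.sum_congr rfl fun u _ => by ring
  -- The term `t = s` shares the codeword of `s`. For `t ≠ s` the codewords are independent and the
  -- mean factorises; adding a nonnegative term at `t = s` completes these to `outLaw`.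
  rw [e, e2, ← Finset.add_sum_erase _ _ (Finset.mem_univ s),
    sum_prod_mul_apply hQs s (fun u => a u * V s u y)]
  refine add_le_add le_rfl ?_
  calc _ = ∑ t ∈ Finset.univ.erase s, p t * ((∑ u, Q s u * a u) * ∑ u, Q t u * V t u y) := by
        refine Finset.sum_congr rfl fun t ht => ?_
        rw [sum_prod_mul_apply_mul_apply hQs (Finset.ne_of_mem_erase ht).symm a
          (fun u => V t u y)]
    _ ≤ _ := by
        refine Finset.sum_le_sum_of_subset_of_nonneg (Finset.erase_subset _ _) fun t _ _ => ?_
        exact mul_nonneg (hp t) (mul_nonneg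
          (Finset.sum_nonneg fun u _ => mul_nonneg (hQ _ _) (ha u))
          (Finset.sum_nonneg fun u _ => mul_nonneg (hQ _ _) (hV _ _ _)))

/-- The random-coding lower bound on the average information of a codebook. -/
lemma le_sum_codebook_mul_codeInfo [DecidableEq S] (hp : ∀ s, 0 ≤ p s)
    (hQ : ∀ s u, 0 ≤ Q s u) (hQs : ∀ s, ∑ u, Q s u = 1) (hV : ∀ s u y, 0 ≤ V s u y) :
    ∑ s, ∑ u, ∑ y, p s * Q s u * V s u y *
        (Real.log (V s u y) - Real.log (p s * V s u y + outLaw p Q V y)) ≤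
      ∑ f : S → U, (∏ s, Q s (f s)) * codeInfo p V f := by
  have e : ∑ f : S → U, (∏ s, Q s (f s)) * codeInfo p V f = ∑ s, ∑ y, ∑ f : S → U,
      (∏ s, Q s (f s)) *
        (p s * V s (f s) y * (Real.log (V s (f s) y) - Real.log (codeOut p V f y))) := by
    simp_rw [codeInfo, Finset.mul_sum]
    rw [Finset.sum_comm]
    exact Finset.sum_congr rfl fun s _ => by rw [Finset.sum_comm]
  rw [e]
  refine Finset.sum_le_sum fun s _ => ?_
  rw [Finset.sum_comm]
  refine Finset.sum_le_sum fun y _ => ?_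
  -- `c (f s)` dominates the mean of `codeOut` given the codeword of `s`. The tangent of the
  -- logarithm at `c (f s)` replaces conditional Jensen, and its linear correction has nonnegative
  -- mean.
  set c : U → ℝ := fun u => p s * V s u y + outLaw p Q V y with hc
  have hc0 : ∀ u, 0 ≤ c u := fun u =>
    add_nonneg (mul_nonneg (hp s) (hV _ _ _)) (outLaw_nonneg hp hQ hV y)
  have h1 : ∀ f : S → U, (∏ s, Q s (f s)) *
        (p s * V s (f s) y * (Real.log (V s (f s) y) - Real.log (c (f s)))) +
        ((∏ s, Q s (f s)) * (p s * V s (f s) y) -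
        (∏ s, Q s (f s)) * (p s * V s (f s) y / c (f s) * codeOut p V f y)) ≤
      (∏ s, Q s (f s)) *
        (p s * V s (f s) y * (Real.log (V s (f s) y) - Real.log (codeOut p V f y))) := by
    intro f
    have hw : 0 ≤ ∏ s, Q s (f s) := Finset.prod_nonneg fun _ _ => hQ _ _
    rw [← mul_sub, ← mul_add]
    refine mul_le_mul_of_nonneg_left ?_ hw
    rcases (mul_nonneg (hp s) (hV s (f s) y)).eq_or_lt with h0 | h0
    · rw [← h0]; simp
    have hcp : 0 < c (f s) := add_pos_of_pos_of_nonneg h0 (outLaw_nonneg hp hQ hV y)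
    have hop : 0 < codeOut p V f y := h0.trans_le (le_codeOut hp hV f s y)
    have := Real.log_le_sub_one_of_pos (div_pos hop hcp)
    rw [Real.log_div hop.ne' hcp.ne'] at this
    have h2 : p s * V s (f s) y * (Real.log (V s (f s) y) - Real.log (c (f s))) +
        (p s * V s (f s) y - p s * V s (f s) y / c (f s) * codeOut p V f y) =
        p s * V s (f s) y * (Real.log (V s (f s) y) - (Real.log (c (f s)) +
          (codeOut p V f y / c (f s) - 1))) := by ring
    rw [h2]
    refine mul_le_mul_of_nonneg_left ?_ h0.le
    linarith
  have h2 := Finset.sum_le_sum fun f (_ : f ∈ Finset.univ) => h1 f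
  rw [Finset.sum_add_distrib, Finset.sum_sub_distrib,
    sum_prod_mul_apply hQs s
      (fun u => p s * V s u y * (Real.log (V s u y) - Real.log (c u))),
    sum_prod_mul_apply hQs s (fun u => p s * V s u y)] at h2
  have h3 := sum_codebook_mul_codeOut_le hp hQ hQs hV s y (a := fun u => p s * V s u y / c u)
    (fun u => div_nonneg (mul_nonneg (hp s) (hV _ _ _)) (hc0 u))
  have h4 : ∑ u, Q s u * (p s * V s u y / c u * (p s * V s u y + outLaw p Q V y)) =
      ∑ u, Q s u * (p s * V s u y) := by
    refine Finset.sum_congr rfl fun u _ => ?_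
    rcases (mul_nonneg (hp s) (hV s u y)).eq_or_lt with h0 | h0
    · rw [← h0]; simp
    have hcp : 0 < c u := add_pos_of_pos_of_nonneg h0 (outLaw_nonneg hp hQ hV y)
    rw [div_mul_cancel₀ _ hcp.ne']
  have h5 : ∑ u, p s * Q s u * V s u y * (Real.log (V s u y) - Real.log (c u)) =
      ∑ u, Q s u * (p s * V s u y * (Real.log (V s u y) - Real.log (c u))) :=
    Finset.sum_congr rfl fun u _ => by ring
  linarith

/-- Since `a + b ≤ 2 max(a, b)`, each logarithmic term is at least the smaller of the
self-information and the information density, less `log 2`. Passing to `h` and `i` costs the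
deviations. -/
lemma sub_le_sum_codebook_mul_codeInfo [DecidableEq S] (hp : ∀ s, 0 ≤ p s) (hps : ∑ s, p s = 1)
    (hQ : ∀ s u, 0 ≤ Q s u) (hQs : ∀ s, ∑ u, Q s u = 1) (hV : ∀ s u y, 0 ≤ V s u y)
    (hVs : ∀ s u, ∑ y, V s u y = 1) (h i : ℝ) :
    min h i - Real.log 2 - selfDev p h - densityDev p Q V i ≤
      ∑ f : S → U, (∏ s, Q s (f s)) * codeInfo p V f := by
  refine le_trans ?_ (le_sum_codebook_mul_codeInfo hp hQ hQs hV)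
  have e1 : selfDev p h = ∑ s, ∑ u, ∑ y, p s * Q s u * V s u y * |-Real.log (p s) - h| := by
    simp_rw [selfDev, ← Finset.sum_mul, ← Finset.mul_sum, hVs, mul_one, ← Finset.mul_sum, hQs,
      mul_one]
  have e2 : ∀ c : ℝ, c = ∑ s, ∑ u, ∑ y, p s * Q s u * V s u y * c := fun c => by
    simp_rw [← Finset.sum_mul, ← Finset.mul_sum, hVs, mul_one, ← Finset.mul_sum, hQs,
      mul_one, hps, one_mul]
  rw [e2 (min h i - Real.log 2), e1, densityDev]
  simp_rw [← Finset.sum_sub_distrib, ← mul_sub]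
  refine Finset.sum_le_sum fun s _ => Finset.sum_le_sum fun u _ => Finset.sum_le_sum fun y _ => ?_
  rcases (mul_nonneg (mul_nonneg (hp s) (hQ s u)) (hV s u y)).eq_or_lt with h0 | h0
  · rw [← h0]; simp
  refine mul_le_mul_of_nonneg_left ?_ h0.le
  have hp0 : 0 < p s := (hp s).lt_of_ne' fun h => by simp [h] at h0
  have hv0 : 0 < V s u y := (hV s u y).lt_of_ne' fun h => by simp [h] at h0
  have ho : 0 < outLaw p Q V y := h0.trans_le (le_outLaw hp hQ hV s u y)
  have hpv := mul_pos hp0 hv0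
  rw [infoDensity]
  have ha := neg_abs_le (-Real.log (p s) - h)
  have hb := neg_abs_le (Real.log (V s u y) - Real.log (outLaw p Q V y) - i)
  have ha' := abs_nonneg (-Real.log (p s) - h)
  have hb' := abs_nonneg (Real.log (V s u y) - Real.log (outLaw p Q V y) - i)
  rcases le_total (p s * V s u y) (outLaw p Q V y) with hle | hle
  · have := Real.log_le_log (add_pos hpv ho)
      (show p s * V s u y + outLaw p Q V y ≤ 2 * outLaw p Q V y by linarith)
    rw [Real.log_mul (by norm_num) ho.ne'] at this
    linarith [min_le_right h i]
  · have := Real.log_le_log (add_pos hpv ho)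
      (show p s * V s u y + outLaw p Q V y ≤ 2 * (p s * V s u y) by linarith)
    rw [Real.log_mul (by norm_num) hpv.ne', Real.log_mul hp0.ne' hv0.ne'] at this
    linarith [min_le_left h i]

/-- Some codebook conveys almost `min h i` about the state through the channel `V`, and hardly more
than `j` through the channel `V'`. -/
lemma exists_codebook (hp : ∀ s, 0 ≤ p s) (hps : ∑ s, p s = 1)
    (hQ : ∀ s u, 0 ≤ Q s u) (hQs : ∀ s, ∑ u, Q s u = 1) (hV : ∀ s u y, 0 ≤ V s u y)
    (hVs : ∀ s u, ∑ y, V s u y = 1) {V' : S → U → Z → ℝ} (hV' : ∀ s u z, 0 ≤ V' s u z)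
    (hVs' : ∀ s u, ∑ z, V' s u z = 1) (h i j : ℝ) :
    ∃ f : S → U,
      min h i - (Real.log 2 + 2 * selfDev p h + 2 * densityDev p Q V i + densityDev p Q V' j) ≤
        codeInfo p V f ∧
      codeInfo p V' f ≤
        j + (Real.log 2 + 2 * selfDev p h + 2 * densityDev p Q V i + densityDev p Q V' j) := by
  classical
  set C := Real.log 2 + 2 * selfDev p h + 2 * densityDev p Q V i + densityDev p Q V' j with hC
  -- Gap to an upper bound on the information through `V`, plus the deviation for `V'`. Both are
  -- nonnegative on codebooks of positive probability, so a bound on the sum controls each; `C` is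
  -- the resulting bound on the mean of `T`.
  set T : (S → U) → ℝ := fun f =>
    (min h i + selfDev p h) + codeDev p Q V i f - codeInfo p V f + codeDev p Q V' j f with hT
  have hω : ∑ f : S → U, ∏ s, Q s (f s) = 1 := sum_prod_eq_one hQs
  have hmean : ∑ f : S → U, (∏ s, Q s (f s)) * T f ≤ C := by
    have := sub_le_sum_codebook_mul_codeInfo hp hps hQ hQs hV hVs h i
    simp_rw [hT, mul_add, mul_sub, mul_add, Finset.sum_add_distrib, Finset.sum_sub_distrib,
      Finset.sum_add_distrib, sum_codebook_mul_codeDev hQs, ← Finset.sum_mul, hω]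
    linarith
  have hex : ∃ f : S → U, 0 < ∏ s, Q s (f s) ∧ T f ≤ C := by
    by_contra hcon
    push Not at hcon
    have h1 : ∑ f : S → U, (∏ s, Q s (f s)) * C < ∑ f : S → U, (∏ s, Q s (f s)) * T f := by
      obtain ⟨f, -, hf⟩ := Finset.exists_ne_zero_of_sum_ne_zero (hω.trans_ne one_ne_zero)
      have hnn : ∀ f : S → U, 0 ≤ ∏ s, Q s (f s) := fun f => Finset.prod_nonneg fun _ _ => hQ _ _
      refine Finset.sum_lt_sum (fun f _ => ?_) ⟨f, Finset.mem_univ _, ?_⟩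
      · rcases (hnn f).eq_or_lt with h0 | h0
        · rw [← h0]; simp
        · exact mul_le_mul_of_nonneg_left (hcon f h0).le h0.le
      · have h0 := (hnn f).lt_of_ne' hf
        exact mul_lt_mul_of_pos_left (hcon f h0) h0
    rw [← Finset.sum_mul, hω, one_mul] at h1
    linarith
  obtain ⟨f, hf, hTf⟩ := hex
  have hpos : ∀ s, 0 < Q s (f s) := fun s =>
    (hQ _ _).lt_of_ne' fun h0 => hf.ne' (Finset.prod_eq_zero (Finset.mem_univ s) h0)
  have b1 := codeInfo_le_add_selfDev hp hps hV hVs h f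
  have b2 := codeInfo_le_add_codeDev hp hps hQ hQs hV hVs i hpos
  have b3 := codeInfo_le_add_codeDev hp hps hQ hQs hV' hVs' j hpos
  have n1 : 0 ≤ codeDev p Q V i f := Finset.sum_nonneg fun s _ => Finset.sum_nonneg fun y _ =>
    mul_nonneg (mul_nonneg (hp s) (hV _ _ _)) (abs_nonneg _)
  have n2 : 0 ≤ codeDev p Q V' j f := Finset.sum_nonneg fun s _ => Finset.sum_nonneg fun y _ =>
    mul_nonneg (mul_nonneg (hp s) (hV' _ _ _)) (abs_nonneg _)
  have n3 : 0 ≤ selfDev p h := Finset.sum_nonneg fun s _ => mul_nonneg (hp s) (abs_nonneg _)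
  have hb : codeInfo p V f ≤ min h i + selfDev p h + codeDev p Q V i f := by
    rcases min_cases h i with ⟨he, -⟩ | ⟨he, -⟩ <;> rw [he] <;> linarith
  simp only [hT] at hTf
  exact ⟨f, by linarith, by linarith⟩

end RandomCoding

/-! ### Deviations for memoryless blocks. -/

section Blocks

variable {S U Y : Type*} [Fintype S] [Fintype U] [Fintype Y]
  {p : S → ℝ} {Q : S → U → ℝ} {V : S → U → Y → ℝ}

lemma outLaw_prod {n : ℕ} (y : Fin n → Y) :
    outLaw (fun s : Fin n → S => ∏ k, p (s k)) (fun s (u : Fin n → U) => ∏ k, Q (s k) (u k))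
      (fun s u (y : Fin n → Y) => ∏ k, V (s k) (u k) (y k)) y = ∏ k, outLaw p Q V (y k) := by
  classical
  simp_rw [outLaw, ← Finset.prod_mul_distrib]
  rw [Finset.prod_univ_sum, Fintype.piFinset_univ]
  refine Finset.sum_congr rfl fun s _ => ?_
  rw [Finset.prod_univ_sum, Fintype.piFinset_univ]

lemma exists_selfDev_prod_le (hp : ∀ s, 0 ≤ p s) (hps : ∑ s, p s = 1) :
    ∃ K : ℝ, ∀ n : ℕ, selfDev (fun s : Fin n → S => ∏ k, p (s k))
      (n * ∑ s, p s * -Real.log (p s)) ≤ K * √n := by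
  obtain ⟨K, hK⟩ := exists_sum_prod_mul_abs_le hp hps (fun s => -Real.log (p s))
  refine ⟨K, fun n => le_trans (le_of_eq ?_) (hK n)⟩
  refine Finset.sum_congr rfl fun s _ => ?_
  -- The logarithm of a product splits only if no factor vanishes; other tuples have weight zero.
  by_cases h0 : ∏ k, p (s k) = 0
  · simp [h0]
  · rw [Real.log_prod fun k _ hk => h0 (Finset.prod_eq_zero (Finset.mem_univ k) hk),
      Finset.sum_neg_distrib]

/-- The triples `(s_k, u_k, y_k)` are i.i.d., and by `outLaw_prod` the block density is the sum of
the letter densities wherever the weight is positive. -/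
lemma exists_densityDev_prod_le (hp : ∀ s, 0 ≤ p s) (hps : ∑ s, p s = 1)
    (hQ : ∀ s u, 0 ≤ Q s u) (hQs : ∀ s, ∑ u, Q s u = 1) (hV : ∀ s u y, 0 ≤ V s u y)
    (hVs : ∀ s u, ∑ y, V s u y = 1) :
    ∃ K : ℝ, ∀ n : ℕ, densityDev (fun s : Fin n → S => ∏ k, p (s k))
      (fun s (u : Fin n → U) => ∏ k, Q (s k) (u k))
      (fun s u (y : Fin n → Y) => ∏ k, V (s k) (u k) (y k))
      (n * ∑ s, ∑ u, ∑ y, p s * Q s u * V s u y * infoDensity p Q V s u y) ≤ K * √n := by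
  obtain ⟨K, hK⟩ := exists_sum_prod_mul_abs_le
    (r := fun t : S × U × Y => p t.1 * Q t.1 t.2.1 * V t.1 t.2.1 t.2.2)
    (fun t => mul_nonneg (mul_nonneg (hp _) (hQ _ _)) (hV _ _ _))
    (by simp_rw [Fintype.sum_prod_type, ← Finset.mul_sum, hVs, mul_one, ← Finset.mul_sum, hQs,
          mul_one, hps])
    (fun t => infoDensity p Q V t.1 t.2.1 t.2.2)
  refine ⟨K, fun n => le_trans (le_of_eq ?_) (hK n)⟩
  simp_rw [Fintype.sum_prod_type]
  rw [densityDev]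
  let e : (Fin n → S × U × Y) ≃ (Fin n → S) × (Fin n → U) × (Fin n → Y) :=
    (Equiv.arrowProdEquivProdArrow _ _ _).trans
      ((Equiv.refl _).prodCongr (Equiv.arrowProdEquivProdArrow _ _ _))
  refine Eq.trans ?_ (Fintype.sum_equiv e _ (fun t => (∏ k, p (t.1 k) * Q (t.1 k) (t.2.1 k) *
      V (t.1 k) (t.2.1 k) (t.2.2 k)) * |∑ k, infoDensity p Q V (t.1 k) (t.2.1 k) (t.2.2 k) -
        n * ∑ s, ∑ u, ∑ y, p s * Q s u * V s u y * infoDensity p Q V s u y|) (fun t => rfl)).symm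
  simp_rw [Fintype.sum_prod_type]
  refine Finset.sum_congr rfl fun s _ => Finset.sum_congr rfl fun u _ =>
    Finset.sum_congr rfl fun y _ => ?_
  rw [← Finset.prod_mul_distrib, ← Finset.prod_mul_distrib]
  by_cases h0 : ∏ k, p (s k) * Q (s k) (u k) * V (s k) (u k) (y k) = 0
  · simp [h0]
  have hne : ∀ k, p (s k) * Q (s k) (u k) * V (s k) (u k) (y k) ≠ 0 := fun k hk =>
    h0 (Finset.prod_eq_zero (Finset.mem_univ k) hk)
  congr 3
  rw [infoDensity, outLaw_prod, Real.log_prod fun k _ => right_ne_zero_of_mul (hne k),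
    Real.log_prod, ← Finset.sum_sub_distrib]
  · rfl
  · intro k _
    exact (((mul_nonneg (mul_nonneg (hp _) (hQ _ _)) (hV _ _ _)).lt_of_ne' (hne k)).trans_le
      (le_outLaw hp hQ hV _ _ _)).ne'

end Blocks

/-! ### Product laws, disintegration and mutual information of a channel. -/

section Laws

lemma sum_toReal_eq_one {α : Type*} [Fintype α] (μ : PMF α) : ∑ a, (μ a).toReal = 1 := by
  rw [← ENNReal.toReal_sum fun a _ => μ.apply_ne_top a, ← tsum_fintype (L := .unconditional _),
    μ.tsum_coe, ENNReal.toReal_one]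

lemma productPMF_apply {n : ℕ} {α : Type*} [Fintype α] (μ : Fin n → PMF α) (a : Fin n → α) :
    productPMF μ a = ∏ i, μ i (a i) := rfl

lemma productPMF_bind {n : ℕ} {α β : Type*} [Fintype α] [Fintype β] (μ : Fin n → PMF α)
    (K : Fin n → α → PMF β) :
    ((productPMF μ).bind fun a => productPMF fun i => K i (a i)) =
      productPMF fun i => (μ i).bind (K i) := by
  classical
  ext b
  simp_rw [PMF.bind_apply, productPMF_apply, PMF.bind_apply, tsum_fintype,
    ← Finset.prod_mul_distrib]
  rw [Finset.prod_univ_sum, Fintype.piFinset_univ]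

lemma productPMF_pure {n : ℕ} {α : Type*} [Fintype α] (a : Fin n → α) :
    (productPMF fun i => PMF.pure (a i)) = PMF.pure a := by
  classical
  ext b
  simp only [productPMF_apply, PMF.pure_apply, Finset.prod_ite_zero, Finset.prod_const_one]
  simp [funext_iff]

lemma productPMF_map {n : ℕ} {α β : Type*} [Fintype α] [Fintype β] (μ : Fin n → PMF α)
    (g : α → β) :
    (productPMF μ).map (fun a i => g (a i)) = productPMF fun i => (μ i).map g := by
  simp_rw [← PMF.bind_pure_comp, ← productPMF_bind]
  congr 1
  funext a
  exact (productPMF_pure _).symm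

lemma bind_map_mk_apply {α β : Type*} (μ : PMF α) (K : α → PMF β) (a : α) (b : β) :
    (μ.bind fun a => (K a).map (Prod.mk a)) (a, b) = μ a * K a b := by
  classical
  rw [PMF.bind_apply, tsum_eq_single a]
  · rw [PMF.map_apply, tsum_eq_single b]
    · simp
    · intro b' hb; simp [hb.symm]
  · intro a' ha
    rw [PMF.map_apply]
    simp [ha.symm]

/-- Disintegration of a law on a product of finite types. -/
lemma exists_eq_bind_map_mk {α β : Type*} [Fintype α] [Fintype β] (μ : PMF (α × β)) :
    ∃ K : α → PMF β, μ = (μ.map Prod.fst).bind fun a => (K a).map (Prod.mk a) := by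
  classical
  have hm : ∀ a, μ.map Prod.fst a = ∑ b, μ (a, b) := fun a => by
    rw [PMF.map_apply, tsum_fintype, Fintype.sum_prod_type, Finset.sum_eq_single a]
    · simp
    · intro a' _ ha; simp [ha.symm]
    · simp
  have : Nonempty β := ⟨μ.support_nonempty.some.2⟩
  -- On null `a` any law serves.
  refine ⟨fun a => if h : μ.map Prod.fst a = 0 then PMF.pure (Classical.arbitrary β) else
    PMF.ofFintype (fun b => μ (a, b) / μ.map Prod.fst a) ?_, ?_⟩
  · simp_rw [div_eq_mul_inv]
    rw [← Finset.sum_mul, ← hm, ENNReal.mul_inv_cancel h (PMF.apply_ne_top _ _)]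
  · ext ⟨a, b⟩
    rw [bind_map_mk_apply]
    by_cases h : μ.map Prod.fst a = 0
    · have h' := hm a
      rw [h, eq_comm, Finset.sum_eq_zero_iff] at h'
      exact (h' b (Finset.mem_univ b)).trans (mul_eq_zero_of_left h _).symm
    · simp only [h, dite_false, PMF.ofFintype_apply]
      rw [ENNReal.mul_div_cancel h (PMF.apply_ne_top _ _)]

/-- Mutual information, in nats, of an input with law `μ` and the output of the channel `K`. -/
lemma mutualInfo_mul_log_two {Ω α β : Type*} [Fintype α] [Fintype β] (P : PMF Ω) (A : Ω → α)
    (B : Ω → β) (μ : PMF α) (K : α → PMF β)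
    (h : P.map (fun ω => (A ω, B ω)) = μ.bind fun a => (K a).map (Prod.mk a)) :
    mutualInfo P A B * Real.log 2 = ∑ a, ∑ b, (μ a).toReal * (K a b).toReal *
      (Real.log (K a b).toReal - Real.log (∑ a, (μ a).toReal * (K a b).toReal)) := by
  have hA : P.map A = μ := by
    have := congrArg (PMF.map Prod.fst) h
    rw [PMF.map_comp, PMF.map_bind] at this
    simp_rw [PMF.map_comp] at this
    refine this.trans ?_
    have : ∀ a : α, (Prod.fst ∘ Prod.mk a : β → α) = Function.const β a := fun a => rfl
    simp_rw [this, PMF.map_const, PMF.bind_pure]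
  have hB : P.map B = μ.bind K := by
    have := congrArg (PMF.map Prod.snd) h
    rw [PMF.map_comp, PMF.map_bind] at this
    simp_rw [PMF.map_comp] at this
    refine this.trans ?_
    have : ∀ a : α, (Prod.snd ∘ Prod.mk a : β → β) = id := fun a => rfl
    simp_rw [this, PMF.map_id]
  have hBr : ∀ b, ((μ.bind K) b).toReal = ∑ a, (μ a).toReal * (K a b).toReal := fun b => by
    rw [PMF.bind_apply, tsum_fintype, ENNReal.toReal_sum fun a _ =>
      ENNReal.mul_ne_top (PMF.apply_ne_top _ _) (PMF.apply_ne_top _ _)]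
    simp_rw [ENNReal.toReal_mul]
  have hl : Real.log 2 ≠ 0 := (Real.log_pos one_lt_two).ne'
  rw [mutualInfo, rvEntropy, rvEntropy, rvEntropy, h, hA, hB, entropy, entropy, entropy,
    ← add_div, ← sub_div, div_mul_cancel₀ _ hl, Fintype.sum_prod_type]
  simp_rw [bind_map_mk_apply, hBr, ENNReal.toReal_mul, Real.negMulLog]
  -- The marginal entropies are spread over the pairs, so that the identity can be checked termwise.
  have e1 : ∑ a, -(μ a).toReal * Real.log (μ a).toReal =
      ∑ a, ∑ b, -((μ a).toReal * (K a b).toReal) * Real.log (μ a).toReal := by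
    refine Finset.sum_congr rfl fun a _ => ?_
    rw [← Finset.sum_mul, Finset.sum_neg_distrib, ← Finset.mul_sum, sum_toReal_eq_one, mul_one]
  have e2 : ∑ b, -(∑ a, (μ a).toReal * (K a b).toReal) *
        Real.log (∑ a, (μ a).toReal * (K a b).toReal) =
      ∑ a, ∑ b, -((μ a).toReal * (K a b).toReal) *
        Real.log (∑ a, (μ a).toReal * (K a b).toReal) := by
    rw [Finset.sum_comm]
    refine Finset.sum_congr rfl fun b _ => ?_
    rw [← Finset.sum_mul, Finset.sum_neg_distrib]
  rw [e1, e2, ← Finset.sum_add_distrib, ← Finset.sum_sub_distrib]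
  refine Finset.sum_congr rfl fun a _ => ?_
  rw [← Finset.sum_add_distrib, ← Finset.sum_sub_distrib]
  refine Finset.sum_congr rfl fun b _ => ?_
  by_cases ha : (μ a).toReal = 0
  · simp [ha]
  by_cases hb : (K a b).toReal = 0
  · simp [hb]
  rw [Real.log_mul ha hb]
  ring

end Laws

/-! ### From the laws of the model to the one-shot quantities. -/

noncomputable section Coding

variable {S U X Y Z T : Type*} [Fintype S] [Fintype U] [Fintype X] [Fintype Y] [Fintype Z]
  [Fintype T]

/-- The channel from `(s, u)` to `g (y, z)` when `x` is drawn from `κ s u`. -/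
def inducedChannel (W : X → S → PMF (Y × Z)) (κ : S → U → PMF X) (g : Y × Z → T)
    (s : S) (u : U) : PMF T :=
  (κ s u).bind fun x => (W x s).map g

/-- The encoder that draws `x_i` from `κ s_i u_i`, where `u = f s` is the codeword of `s`. -/
def codebookEncoder (κ : S → U → PMF X) {n : ℕ} (f : (Fin n → S) → (Fin n → U)) :
    Encoder S X n :=
  fun s => productPMF fun i => κ (s i) (f s i)

variable (p : PMF S) (W : X → S → PMF (Y × Z)) (κ : S → U → PMF X) (g : Y × Z → T)

/-- Given `s`, the inputs are independent across letters, so averaging them out leaves a memoryless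
channel from `(s, f s)`. The map `g` selects the receiver: `Prod.fst` for `Y`, `Prod.snd` for `Z`.
-/
lemma blockLaw_map_codebookEncoder {n : ℕ} (f : (Fin n → S) → (Fin n → U)) :
    (blockLaw p W (codebookEncoder κ f)).map
        (fun ω => (ω.1, fun i => g (ω.2.1 i, ω.2.2 i))) =
      (productPMF fun _ => p).bind fun s =>
        (productPMF fun i => inducedChannel W κ g (s i) (f s i)).map (Prod.mk s) := by
  rw [blockLaw, PMF.map_bind]
  congr 1
  funext s
  rw [PMF.map_bind]
  simp_rw [PMF.map_comp]
  have h1 : (productPMF fun i => inducedChannel W κ g (s i) (f s i)) =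
      (codebookEncoder κ f s).bind fun x =>
        (productPMF fun i => W (x i) (s i)).map fun a i => g (a i) := by
    simp_rw [productPMF_map]
    exact (productPMF_bind _ fun i x => (W x (s i)).map g).symm
  rw [h1, PMF.map_bind]
  simp_rw [PMF.map_comp]
  rfl

lemma mutualInfo_blockLaw_mul_log_two {n : ℕ} (f : (Fin n → S) → (Fin n → U)) :
    mutualInfo (blockLaw p W (codebookEncoder κ f)) (fun ω => ω.1)
        (fun ω i => g (ω.2.1 i, ω.2.2 i)) * Real.log 2 =
      codeInfo (fun s : Fin n → S => ∏ i, (p (s i)).toReal)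
        (fun s (u : Fin n → U) (y : Fin n → T) =>
          ∏ i, (inducedChannel W κ g (s i) (u i) (y i)).toReal) f := by
  rw [mutualInfo_mul_log_two _ _ _ _ _ (blockLaw_map_codebookEncoder p W κ g f)]
  simp_rw [productPMF_apply, ENNReal.toReal_prod]
  rfl

variable {p W κ}

lemma letterLaw_map {q : S → PMF (U × X)}
    (hq : ∀ s, q s = ((q s).map Prod.fst).bind fun u => (κ s u).map (Prod.mk u)) :
    (letterLaw p W q).map (fun ω => ((ω.2.1, ω.1), g (ω.2.2.2.1, ω.2.2.2.2))) =
      (p.bind fun s => ((q s).map Prod.fst).map fun u => (u, s)).bind fun us =>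
        (inducedChannel W κ g us.2 us.1).map (Prod.mk us) := by
  rw [letterLaw, PMF.map_bind, PMF.bind_bind]
  congr 1
  funext s
  conv_lhs => rw [hq s]
  generalize (q s).map Prod.fst = ν
  rw [PMF.bind_bind, PMF.map_bind, PMF.bind_map]
  congr 1
  funext u
  rw [PMF.bind_map, PMF.map_bind]
  simp only [Function.comp_def, inducedChannel]
  rw [PMF.map_bind]
  simp_rw [PMF.map_comp]
  rfl

lemma mutualInfo_letterLaw_mul_log_two {q : S → PMF (U × X)}
    (hq : ∀ s, q s = ((q s).map Prod.fst).bind fun u => (κ s u).map (Prod.mk u)) :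
    mutualInfo (letterLaw p W q) (fun ω => (ω.2.1, ω.1))
        (fun ω => g (ω.2.2.2.1, ω.2.2.2.2)) * Real.log 2 =
      ∑ s, ∑ u, ∑ t, (p s).toReal * ((q s).map Prod.fst u).toReal *
        (inducedChannel W κ g s u t).toReal *
        infoDensity (fun s => (p s).toReal) (fun s u => ((q s).map Prod.fst u).toReal)
          (fun s u t => (inducedChannel W κ g s u t).toReal) s u t := by
  have hμ : ∀ u s, (p.bind fun s => ((q s).map Prod.fst).map fun u => (u, s)) (u, s) =
      p s * (q s).map Prod.fst u := fun u s => by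
    rw [← bind_map_mk_apply p (fun s => (q s).map Prod.fst) s u]
    have := congrArg (fun ν : PMF (U × S) => ν (u, s)) (PMF.map_bind p
      (fun s => ((q s).map Prod.fst).map (Prod.mk s)) Prod.swap)
    simp_rw [PMF.map_comp _ ((q _).map Prod.fst)] at this
    refine Eq.trans this.symm ?_
    classical
    rw [PMF.map_apply, tsum_eq_single (s, u)]
    · simp
    · rintro ⟨s', u'⟩ hne
      rw [if_neg]
      rintro h
      simp only [Prod.swap_prod_mk, Prod.mk.injEq] at h
      exact hne (by rw [h.1, h.2])
  rw [mutualInfo_mul_log_two _ _ _ _ _ (letterLaw_map g hq)]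
  simp_rw [Fintype.sum_prod_type, hμ, ENNReal.toReal_mul, infoDensity, outLaw]
  rw [Finset.sum_comm]
  refine Finset.sum_congr rfl fun s _ => Finset.sum_congr rfl fun u _ =>
    Finset.sum_congr rfl fun t _ => ?_
  congr 3
  rw [Finset.sum_comm]

lemma rvEntropy_letterLaw_mul_log_two (q : S → PMF (U × X)) :
    rvEntropy (letterLaw p W q) (fun ω => ω.1) * Real.log 2 =
      ∑ s, (p s).toReal * -Real.log (p s).toReal := by
  have h : (letterLaw p W q).map (fun ω => ω.1) = p := by
    rw [letterLaw, PMF.map_bind]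
    simp_rw [PMF.map_bind, PMF.map_comp]
    have : ∀ (s : S) (ux : U × X), ((fun ω : S × U × X × Y × Z => ω.1) ∘ fun yz : Y × Z =>
      (s, ux.1, ux.2, yz.1, yz.2)) = Function.const _ s := fun s ux => rfl
    simp_rw [this, PMF.map_const, PMF.bind_const, PMF.bind_pure]
  rw [rvEntropy, h, entropy, div_mul_cancel₀ _ (Real.log_pos one_lt_two).ne']
  exact Finset.sum_congr rfl fun s _ => by rw [Real.negMulLog]; ring

end Coding

/-! ### Asymptotics and closure. -/

section Achievability

variable {S X Y Z : Type*} [Fintype S] [Fintype X] [Fintype Y] [Fintype Z]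

lemma eventually_add_mul_sqrt_le (a b : ℝ) {c : ℝ} (hc : 0 < c) :
    ∀ᶠ n : ℕ in atTop, a + b * √n ≤ c * n := by
  have ht : Tendsto (fun n : ℕ => √(n : ℝ)) atTop atTop :=
    Real.tendsto_sqrt_atTop.comp tendsto_natCast_atTop_atTop
  -- Once `√n ≥ 1`, the left side is at most `(|a| + b)√n`.
  filter_upwards [ht.eventually_ge_atTop 1, ht.eventually_ge_atTop ((|a| + b) / c)] with n h1 h2
  have hs : √(n : ℝ) * √n = n := Real.mul_self_sqrt (by positivity)
  rw [div_le_iff₀ hc] at h2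
  nlinarith [le_abs_self a, abs_nonneg a]

lemma achievable_of_mem_messagingPairs (p : PMF S) (W : X → S → PMF (Y × Z)) {U : Type*}
    [Fintype U] (q : S → PMF (U × X)) {r : ℝ × ℝ} (hr : r ∈ messagingPairs p W q) :
    Achievable p W r := by
  obtain ⟨hra, hrl, -⟩ := hr
  -- Splits `p(u,x|s)` into `p(u|s)`, which generates codewords, and `κ = p(x|s,u)`, which the
  -- encoder simulates.
  choose κ hq using fun s => exists_eq_bind_map_mk (q s)
  set pr : S → ℝ := fun s => (p s).toReal
  set Q : S → U → ℝ := fun s u => ((q s).map Prod.fst u).toReal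
  set V : S → U → Y → ℝ := fun s u y => (inducedChannel W κ Prod.fst s u y).toReal
  set V' : S → U → Z → ℝ := fun s u z => (inducedChannel W κ Prod.snd s u z).toReal
  have hp : ∀ s, 0 ≤ pr s := fun _ => ENNReal.toReal_nonneg
  have hQ : ∀ s u, 0 ≤ Q s u := fun _ _ => ENNReal.toReal_nonneg
  have hV : ∀ s u y, 0 ≤ V s u y := fun _ _ _ => ENNReal.toReal_nonneg
  have hV' : ∀ s u z, 0 ≤ V' s u z := fun _ _ _ => ENNReal.toReal_nonneg
  have hps : ∑ s, pr s = 1 := sum_toReal_eq_one p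
  have hQs : ∀ s, ∑ u, Q s u = 1 := fun s => sum_toReal_eq_one _
  have hVs : ∀ s u, ∑ y, V s u y = 1 := fun s u => sum_toReal_eq_one _
  have hVs' : ∀ s u, ∑ z, V' s u z = 1 := fun s u => sum_toReal_eq_one _
  obtain ⟨K₁, hK₁⟩ := exists_selfDev_prod_le hp hps
  obtain ⟨K₂, hK₂⟩ := exists_densityDev_prod_le hp hps hQ hQs hV hVs
  obtain ⟨K₃, hK₃⟩ := exists_densityDev_prod_le hp hps hQ hQs hV' hVs'
  have hH := rvEntropy_letterLaw_mul_log_two (p := p) (W := W) q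
  have hI := mutualInfo_letterLaw_mul_log_two (p := p) (W := W) Prod.fst hq
  have hJ := mutualInfo_letterLaw_mul_log_two (p := p) (W := W) Prod.snd hq
  set h := ∑ s, pr s * -Real.log (pr s)
  set i := ∑ s, ∑ u, ∑ y, pr s * Q s u * V s u y * infoDensity pr Q V s u y
  set j := ∑ s, ∑ u, ∑ z, pr s * Q s u * V' s u z * infoDensity pr Q V' s u z
  have hl : 0 < Real.log 2 := Real.log_pos one_lt_two
  have hra' : r.1 * Real.log 2 ≤ min h i := by
    rw [← hH, ← hI, ← min_mul_of_nonneg _ _ hl.le]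
    exact mul_le_mul_of_nonneg_right hra hl.le
  have hrl' : j ≤ r.2 * Real.log 2 := by
    rw [← hJ]
    exact mul_le_mul_of_nonneg_right hrl hl.le
  intro ε hε
  -- The coefficients are those of the error term in `exists_codebook`; the factor `log 2` in `ε *
  -- log 2` converts bits to nats.
  filter_upwards [eventually_add_mul_sqrt_le (Real.log 2) (2 * K₁ + 2 * K₂ + K₃)
    (mul_pos hε hl), eventually_gt_atTop 0] with n hn hn0
  have hn0' : (0 : ℝ) < n := by exact_mod_cast hn0
  obtain ⟨f, hfY, hfZ⟩ := exists_codebook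
    (p := fun s : Fin n → S => ∏ k, pr (s k))
    (Q := fun s (u : Fin n → U) => ∏ k, Q (s k) (u k))
    (V := fun s u (y : Fin n → Y) => ∏ k, V (s k) (u k) (y k))
    (V' := fun s u (z : Fin n → Z) => ∏ k, V' (s k) (u k) (z k))
    (fun s => Finset.prod_nonneg fun _ _ => hp _) (sum_prod_eq_one (r := fun _ => pr) fun _ => hps)
    (fun s u => Finset.prod_nonneg fun _ _ => hQ _ _)
    (fun s => sum_prod_eq_one (r := fun k => Q (s k)) fun _ => hQs _)
    (fun s u y => Finset.prod_nonneg fun _ _ => hV _ _ _)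
    (fun s u => sum_prod_eq_one (r := fun k => V (s k) (u k)) fun _ => hVs _ _)
    (fun s u y => Finset.prod_nonneg fun _ _ => hV' _ _ _)
    (fun s u => sum_prod_eq_one (r := fun k => V' (s k) (u k)) fun _ => hVs' _ _)
    (n * h) (n * i) (n * j)
  have k₁ := hK₁ n
  have k₂ := hK₂ n
  have k₃ := hK₃ n
  have hY := mutualInfo_blockLaw_mul_log_two p W κ Prod.fst f
  have hZ := mutualInfo_blockLaw_mul_log_two p W κ Prod.snd f
  rw [← mul_min_of_nonneg _ _ hn0'.le, ← hY] at hfY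
  rw [← hZ] at hfZ
  refine ⟨codebookEncoder κ f, ?_, ?_⟩
  · rw [one_div, inv_mul_eq_div, le_div_iff₀ hn0']
    refine le_of_mul_le_mul_right ?_ hl
    refine le_trans ?_ hfY
    have := mul_le_mul_of_nonneg_left hra' hn0'.le
    linarith
  · rw [one_div, inv_mul_eq_div, div_le_iff₀ hn0']
    refine le_of_mul_le_mul_right ?_ hl
    refine hfZ.trans ?_
    have := mul_le_mul_of_nonneg_left hrl' hn0'.le
    linarith

/-- Half of `ε` pays for moving to a nearby achievable pair, half for the encoder of that pair. -/
lemma isClosed_tradeoffRegion (p : PMF S) (W : X → S → PMF (Y × Z)) :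
    IsClosed (tradeoffRegion p W) := by
  refine isClosed_of_closure_subset fun r hr ε hε => ?_
  obtain ⟨r', hr', hd⟩ := Metric.mem_closure_iff.1 hr (ε / 2) (half_pos hε)
  filter_upwards [hr' (ε / 2) (half_pos hε)] with n ⟨f, h1, h2⟩
  have h3 := (le_max_left _ _).trans_lt (Prod.dist_eq (x := r) (y := r') ▸ hd)
  have h4 := (le_max_right _ _).trans_lt (Prod.dist_eq (x := r) (y := r') ▸ hd)
  rw [Real.dist_eq, abs_lt] at h3 h4
  exact ⟨f, by linarith, by linarith⟩

end Achievability

end StateAmplification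

theorem mainTheorem2 {S X Y Z : Type*} [Fintype S] [Fintype X] [Fintype Y] [Fintype Z]
    (p : PMF S) (W : X → S → PMF (Y × Z)) :
    StateAmplification.messagingRegion p W ⊆ StateAmplification.tradeoffRegion p W := by
  refine closure_minimal ?_ (StateAmplification.isClosed_tradeoffRegion p W)
  rintro r ⟨U, _, q, hr⟩
  exact StateAmplification.achievable_of_mem_messagingPairs p W q hr
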